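/- Let $\mathbb{F}$ be a field, let $k,p\ge 0$, and let $\mathbb{F}[\mathbf{x}_{k\times p}]$ be the polynomial ring in the variables $x_{i,j}$ ($1\le i\le k$, $1\le j\le p$). For a $k\times p$ matrix $A=(a_{i,j})$ over $\mathbb{Z}_{\ge 0}$ write $\mathbf{x}^A=\prod_{i,j}x_{i,j}^{a_{i,j}}$, and let $\mathrm{row}(A)$ and $\mathrm{col}(A)$ be its vectors of row sums and of column sums. *Matrix-ball construction.* Place $a_{i,j}$ balls in cell $(i,j)$ of a $k\times p$ grid, arranged from northwest to southeast. Say that a ball $b'$ precedes a ball $b\neq b'$ if either $b'$ and $b$ lie in different cells $(i',j')\ne(i,j)$ with $i'\le i$ and $j'\le j$, or they lie in the same cell and $b'$ is northwest of $b$ there. Label the balls recursively: a ball with no preceding ball has label $1$; any other ball has label one more than the maximum label of the balls preceding it. A ball is northern (respectively western) if it has the smallest row index (respectively column index) among the balls with the same label. For each label $\ell$ the balls labeled $\ell$ lie in distinct positions $(i_1,j_1),\dots,(i_m,j_m)$ with $i_1<\dots<i_m$ and $j_1>\dots>j_m$; let $B_\ell$ be the $0,1$-matrix whose ones are exactly in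 positions $(i_2,j_1),(i_3,j_2),\dots,(i_m,j_{m-1})$. Set $A^{(2)}:=\sum_\ell B_\ell$ and $\mathfrak{mb}(A):=\mathbf{x}^{A^{(2)}}$. *Statement.* Let $n\ge 0$ and let $\alpha=(\alpha_1,\dots,\alpha_k)$ and $\beta=(\beta_1,\dots,\beta_p)$ be sequences of nonnegative integers, each with sum $n$. Let $\mathcal{C}_{\alpha,\beta}$ be the set of $k\times p$ matrices $A$ over $\mathbb{Z}_{\ge0}$ with $\mathrm{row}(A)=\alpha$ and $\mathrm{col}(A)=\beta$, and let $\mathcal{S}_{\alpha,\beta}$ be the set of those $B$ with $\mathrm{row}(B)\le\alpha$ and $\mathrm{col}(B)\le\beta$ componentwise. Let $B\in\mathcal{S}_{\alpha,\beta}$, label the balls of $B$ as above, and let $x_i$ be the number of northern balls in row $i$ and $y_j$ the number of western balls in column $j$. Then $\mathbf{x}^B=\mathfrak{mb}(A)$ for some $A\in\mathcal{C}_{\alpha,\beta}$ if and only if $$\sum_{q=1}^{i}x_q\le\sum_{q=1}^{i-1}\bigl(\alpha_q-\mathrm{row}(B)_q\bigr)\quad\text{for all }1\le i\le k$$ and $$\sum_{q=1}^{j}y_q\le\sum_{q=1}^{j-1}\bigl(\beta_q-\mathrm{col}(B)_q\bigr)\quad\text{for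 all }1\le j\le p.$$ -/

import Mathlib

namespace MatrixBall

open Finset

variable {k p : ℕ}

/-- The row vector (row sums) of a matrix. -/
def rowVec (A : Matrix (Fin k) (Fin p) ℕ) (i : Fin k) : ℕ := ∑ j, A i j

/-- The column vector (column sums) of a matrix. -/
def colVec (A : Matrix (Fin k) (Fin p) ℕ) (j : Fin p) : ℕ := ∑ i, A i j

/-- `α` is a weak composition of `n` (with `k` parts). -/
def IsWeakComposition (n : ℕ) (α : Fin k → ℕ) : Prop := ∑ i, α i = n

/-- The set `C_{α,β}` of contingency tables: row sums `α`, column sums `β`. -/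
def contingencyTables (α : Fin k → ℕ) (β : Fin p → ℕ) : Set (Matrix (Fin k) (Fin p) ℕ) :=
  {A | (∀ i, rowVec A i = α i) ∧ (∀ j, colVec A j = β j)}

/-- The set `S_{α,β}` of subtingency tables: row sums at most `α`, column sums at most `β`. -/
def subtingencyTables (α : Fin k → ℕ) (β : Fin p → ℕ) : Set (Matrix (Fin k) (Fin p) ℕ) :=
  {B | (∀ i, rowVec B i ≤ α i) ∧ (∀ j, colVec B j ≤ β j)}

/-- The balls of `A`: the cell `(i, j)` holds `A i j` balls, listed by their position
`0, 1, …, A i j - 1` from northwest to southeast. -/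
abbrev Ball (A : Matrix (Fin k) (Fin p) ℕ) : Type := Σ c : Fin k × Fin p, Fin (A c.1 c.2)

/-- Row index of a ball. -/
def Ball.row {A : Matrix (Fin k) (Fin p) ℕ} (b : Ball A) : Fin k := b.1.1

/-- Column index of a ball. -/
def Ball.col {A : Matrix (Fin k) (Fin p) ℕ} (b : Ball A) : Fin p := b.1.2

/-- Position of a ball inside its cell. -/
def Ball.pos {A : Matrix (Fin k) (Fin p) ℕ} (b : Ball A) : ℕ := b.2.1

/-- `b'` lies (weakly) northwest of `b` and is distinct from it: either `b'` lies in a different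
cell, in a row weakly above and a column weakly to the left, or both lie in the same cell and `b'`
comes first in the northwest to southeast order of that cell. -/
def Ball.Before {A : Matrix (Fin k) (Fin p) ℕ} (b' b : Ball A) : Prop :=
  b'.row ≤ b.row ∧ b'.col ≤ b.col ∧ (b'.row = b.row → b'.col = b.col → b'.pos < b.pos)

instance {A : Matrix (Fin k) (Fin p) ℕ} (b' b : Ball A) : Decidable (b'.Before b) := by
  unfold Ball.Before; infer_instance

/-- The label of a ball: `1` if no ball precedes it, and otherwise one more than the
largest label of a preceding ball (the supremum over the empty set is `0`). -/
def label {A : Matrix (Fin k) (Fin p) ℕ} (b : Ball A) : ℕ :=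
  ((univ : Finset (Ball A)).filter (fun b' => b'.Before b)).attach.sup
    (fun b' => label b'.1) + 1
termination_by ((b.row : ℕ) + (b.col : ℕ), b.pos)
decreasing_by
  have h : Ball.Before b'.1 b := (Finset.mem_filter.mp b'.2).2
  obtain ⟨h1, h2, h3⟩ := h
  rw [Prod.lex_def]
  simp only [Fin.le_def, Fin.ext_iff] at h1 h2 h3
  by_cases hr : (b'.1.row : ℕ) = b.row
  · by_cases hc : (b'.1.col : ℕ) = b.col
    · exact Or.inr ⟨by simp only [hr, hc], h3 hr hc⟩
    · left; simp only; omega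
  · left; simp only; omega

/-- A ball is northern if its row index is smallest among the balls sharing its label. -/
def IsNorthern {A : Matrix (Fin k) (Fin p) ℕ} (b : Ball A) : Prop :=
  ∀ b' : Ball A, label b' = label b → b.row ≤ b'.row

/-- A ball is western if its column index is smallest among the balls sharing its label. -/
def IsWestern {A : Matrix (Fin k) (Fin p) ℕ} (b : Ball A) : Prop :=
  ∀ b' : Ball A, label b' = label b → b.col ≤ b'.col

instance {A : Matrix (Fin k) (Fin p) ℕ} : DecidablePred (IsNorthern (A := A)) :=
  fun b => by unfold IsNorthern; infer_instance

instance {A : Matrix (Fin k) (Fin p) ℕ} : DecidablePred (IsWestern (A := A)) :=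
  fun b => by unfold IsWestern; infer_instance

/-- The number of northern balls in row `i`. -/
def northernCount (A : Matrix (Fin k) (Fin p) ℕ) (i : Fin k) : ℕ :=
  ((univ : Finset (Ball A)).filter (fun b => IsNorthern b ∧ b.row = i)).card

/-- The number of western balls in column `j`. -/
def westernCount (A : Matrix (Fin k) (Fin p) ℕ) (j : Fin p) : ℕ :=
  ((univ : Finset (Ball A)).filter (fun b => IsWestern b ∧ b.col = j)).card

/-- `b` and `b'` are consecutive balls of label `l`, read from north to south: both carry the
label `l`, `b` lies strictly above `b'`, and no ball of label `l` lies strictly between. -/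
def Consecutive {A : Matrix (Fin k) (Fin p) ℕ} (l : ℕ) (b b' : Ball A) : Prop :=
  label b = l ∧ label b' = l ∧ b.row < b'.row ∧
    ∀ c : Ball A, label c = l → ¬ (b.row < c.row ∧ c.row < b'.row)

instance {A : Matrix (Fin k) (Fin p) ℕ} (l : ℕ) (b b' : Ball A) :
    Decidable (Consecutive l b b') := by
  unfold Consecutive; infer_instance

/-- The `0,1`-matrix `B_l` of the label `l`. If the balls labelled `l` lie in the positions
`(i_1, j_1), …, (i_m, j_m)` with `i_1 < ⋯ < i_m` (and so `j_1 > ⋯ > j_m`), its ones are in the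
positions `(i_2, j_1), (i_3, j_2), …, (i_m, j_{m-1})`, the southeast corners. -/
def cornerMatrix (A : Matrix (Fin k) (Fin p) ℕ) (l : ℕ) : Matrix (Fin k) (Fin p) ℕ :=
  fun i j => if ∃ b b' : Ball A, Consecutive l b b' ∧ b'.row = i ∧ b.col = j then 1 else 0

/-- The matrix `A^{(2)}` obtained from `A` by one iteration of the matrix-ball construction:
the sum of the matrices `B_l` over all labels `l` that occur. -/
def nextMatrix (A : Matrix (Fin k) (Fin p) ℕ) : Matrix (Fin k) (Fin p) ℕ :=
  ∑ l ∈ (univ : Finset (Ball A)).image label, cornerMatrix A l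

/-- The monomial `x^B = ∏ x_{i,j}^{B_{i,j}}`. -/
noncomputable def xPow (F : Type*) [Field F] (B : Matrix (Fin k) (Fin p) ℕ) :
    MvPolynomial (Fin k × Fin p) F :=
  ∏ i, ∏ j, MvPolynomial.X (i, j) ^ B i j

/-- The matrix-ball monomial of `A`. -/
noncomputable def mb (F : Type*) [Field F] (A : Matrix (Fin k) (Fin p) ℕ) :
    MvPolynomial (Fin k × Fin p) F :=
  xPow F (nextMatrix A)

end MatrixBall

namespace MatrixBall

open Finset

/-- There is a largest element among `r` and the values of `f` at the elements of `X`
satisfying `P`. -/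
theorem exists_max_insert {γ ι : Type*} [LinearOrder ι] (X : Finset γ) (f : γ → ι) (r : ι)
    (P : γ → Prop) :
    ∃ m, (m = r ∨ ∃ b ∈ X, P b ∧ f b = m) ∧ r ≤ m ∧ ∀ b ∈ X, P b → f b ≤ m := by
  classical
  have hne : (insert r ((X.filter P).image f)).Nonempty := insert_nonempty _ _
  refine ⟨max' _ hne, ?_, le_max' _ r (mem_insert_self _ _), fun b hb hP => le_max' _ _ ?_⟩
  · simpa only [mem_insert, mem_image, mem_filter, and_assoc] using max'_mem _ hne
  · exact mem_insert_of_mem (mem_image_of_mem _ (by simp [hb, hP]))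

section Antichains

variable {ι κ : Type*} [LinearOrder ι] [LinearOrder κ]

/-- The southeast corners of a finite antichain of cells, read from north to south. -/
def corners (Y : Finset (ι × κ)) : Finset (ι × κ) :=
  ((Y ×ˢ Y).filter fun w =>
    w.1.1 < w.2.1 ∧ ∀ z ∈ Y, ¬(w.1.1 < z.1 ∧ z.1 < w.2.1)).image fun w => (w.2.1, w.1.2)

theorem mem_corners {Y : Finset (ι × κ)} {i : ι} {j : κ} :
    (i, j) ∈ corners Y ↔ ∃ u ∈ Y, ∃ v ∈ Y, u.1 < v.1 ∧
      (∀ z ∈ Y, ¬(u.1 < z.1 ∧ z.1 < v.1)) ∧ v.1 = i ∧ u.2 = j := by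
  simp only [corners, mem_image, mem_filter, mem_product, Prod.mk.injEq]
  constructor
  · rintro ⟨w, ⟨⟨h1, h2⟩, h3, h4⟩, h5, h6⟩
    exact ⟨_, h1, _, h2, h3, h4, h5, h6⟩
  · rintro ⟨u, h1, v, h2, h3, h4, h5, h6⟩
    exact ⟨(u, v), ⟨⟨h1, h2⟩, h3, h4⟩, h5, h6⟩

theorem snd_lt_of_fst_lt {Y : Finset (ι × κ)} (hY : IsAntichain (· ≤ ·) (Y : Set (ι × κ)))
    {u v : ι × κ} (hu : u ∈ Y) (hv : v ∈ Y) (h : u.1 < v.1) : v.2 < u.2 := by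
  by_contra! h'
  have := hY.eq hu hv (Prod.mk_le_mk.2 ⟨h.le, h'⟩)
  exact h.ne (congrArg Prod.fst this)

theorem fst_lt_of_snd_lt {Y : Finset (ι × κ)} (hY : IsAntichain (· ≤ ·) (Y : Set (ι × κ)))
    {u v : ι × κ} (hu : u ∈ Y) (hv : v ∈ Y) (h : u.2 < v.2) : v.1 < u.1 := by
  by_contra! h'
  have := hY.eq hu hv (Prod.mk_le_mk.2 ⟨h', h.le⟩)
  exact h.ne (congrArg Prod.snd this)

theorem eq_of_fst_eq {Y : Finset (ι × κ)} (hY : IsAntichain (· ≤ ·) (Y : Set (ι × κ)))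
    {u v : ι × κ} (hu : u ∈ Y) (hv : v ∈ Y) (h : u.1 = v.1) : u = v := by
  rcases le_total u.2 v.2 with h' | h'
  · exact hY.eq hu hv (Prod.mk_le_mk.2 ⟨h.le, h'⟩)
  · exact (hY.eq hv hu (Prod.mk_le_mk.2 ⟨h.ge, h'⟩)).symm

theorem isAntichain_map_swap {Y : Finset (ι × κ)} (hY : IsAntichain (· ≤ ·) (Y : Set (ι × κ))) :
    IsAntichain (· ≤ ·) ((Y.map (Equiv.prodComm ι κ).toEmbedding : Finset (κ × ι)) :
      Set (κ × ι)) := by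
  rintro ⟨a, b⟩ hu ⟨c, d⟩ hv hne hle
  simp only [mem_coe, mem_map_equiv, Equiv.prodComm_symm, Equiv.prodComm_apply,
    Prod.swap_prod_mk] at hu hv
  have := hY.eq hu hv (Prod.mk_le_mk.2 ⟨hle.2, hle.1⟩)
  simp only [Prod.mk.injEq] at this
  exact hne (by rw [this.1, this.2])

theorem swap_mem_corners_map_swap {Y : Finset (ι × κ)}
    (hY : IsAntichain (· ≤ ·) (Y : Set (ι × κ))) {i : ι} {j : κ} :
    (j, i) ∈ corners (Y.map (Equiv.prodComm ι κ).toEmbedding) ↔ (i, j) ∈ corners Y := by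
  simp only [mem_corners, mem_map_equiv, Equiv.prodComm_symm, Equiv.prodComm_apply]
  constructor
  · rintro ⟨u, hu, v, hv, huv, hz, rfl, rfl⟩
    refine ⟨_, hv, _, hu, fst_lt_of_snd_lt hY hu hv huv, fun z hzY hzz => ?_, rfl, rfl⟩
    exact hz z.swap (by simpa using hzY)
      ⟨snd_lt_of_fst_lt hY hzY hu hzz.2, snd_lt_of_fst_lt hY hv hzY hzz.1⟩
  · rintro ⟨u, hu, v, hv, huv, hz, rfl, rfl⟩
    refine ⟨v.swap, by simpa using hv, u.swap, by simpa using hu,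
      snd_lt_of_fst_lt hY hu hv huv, fun z hzY hzz => ?_, rfl, rfl⟩
    exact hz _ hzY ⟨fst_lt_of_snd_lt hY hzY hu hzz.2, fst_lt_of_snd_lt hY hv hzY hzz.1⟩

/-- The corners of an antichain form an antichain. -/
theorem isAntichain_corners {Y : Finset (ι × κ)} (hY : IsAntichain (· ≤ ·) (Y : Set (ι × κ))) :
    IsAntichain (· ≤ ·) (corners Y : Set (ι × κ)) := by
  rintro ⟨i, j⟩ hx ⟨i', j'⟩ hy hne hle
  obtain ⟨u, hu, v, hv, huv, hz, rfl, rfl⟩ := mem_corners.1 hx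
  obtain ⟨u', hu', v', hv', huv', hz', rfl, rfl⟩ := mem_corners.1 hy
  obtain ⟨h1, h2⟩ := Prod.mk_le_mk.1 hle
  rcases h1.eq_or_lt with h1 | h1
  · have hvv := eq_of_fst_eq hY hv hv' h1
    subst hvv
    rcases lt_trichotomy u.1 u'.1 with h | h | h
    · exact hz _ hu' ⟨h, huv'⟩
    · exact hne (by rw [eq_of_fst_eq hY hu hu' h])
    · exact hz' _ hu ⟨h, huv⟩
  · have : v.1 ≤ u'.1 := by
      by_contra! h
      exact hz' _ hv ⟨h, h1⟩
    exact absurd (snd_lt_of_fst_lt hY hu hu' (huv.trans_le this)) h2.not_gt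

/-- In an antichain with northernmost row `r`, each row contains as many cells as corners, except
that row `r` contains one cell more. -/
theorem card_row_eq {Y : Finset (ι × κ)} (hY : IsAntichain (· ≤ ·) (Y : Set (ι × κ)))
    {r : ι} (hr : ∀ a ∈ Y, r ≤ a.1) (hr' : ∃ a ∈ Y, a.1 = r) (i : ι) :
    #{a ∈ Y | a.1 = i} = #{a ∈ corners Y | a.1 = i} + if r = i then 1 else 0 := by
  have hone : ∀ Z : Finset (ι × κ), IsAntichain (· ≤ ·) (Z : Set (ι × κ)) →
      #{a ∈ Z | a.1 = i} ≤ 1 := fun Z hZ => card_le_one.2 fun a ha b hb => by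
    simp only [mem_filter] at ha hb
    exact eq_of_fst_eq hZ ha.1 hb.1 (ha.2.trans hb.2.symm)
  have h1 := hone _ hY
  have h2 := hone _ (isAntichain_corners hY)
  split_ifs with h
  · subst h
    have h3 : #{a ∈ corners Y | a.1 = r} = 0 := by
      simp only [card_eq_zero, filter_eq_empty_iff]
      rintro ⟨i, j⟩ hc rfl
      obtain ⟨u, hu, v, hv, huv, hz, rfl, rfl⟩ := mem_corners.1 hc
      exact (hr u hu).not_gt huv
    have h4 : 0 < #{a ∈ Y | a.1 = r} := by
      obtain ⟨a, ha, har⟩ := hr'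
      exact card_pos.2 ⟨a, by simp [ha, har]⟩
    omega
  · have : 0 < #{a ∈ Y | a.1 = i} ↔ 0 < #{a ∈ corners Y | a.1 = i} := by
      simp only [card_pos]
      constructor
      · rintro ⟨v, hv⟩
        simp only [mem_filter] at hv
        obtain ⟨hv, rfl⟩ := hv
        obtain ⟨a, ha, har⟩ := hr'
        have hav : a.1 < v.1 := by
          rw [har]; exact lt_of_le_of_ne (hr v hv) h
        obtain ⟨u, hu, hmax⟩ := exists_max_image {a ∈ Y | a.1 < v.1} Prod.fst
          ⟨a, by simp [ha, hav]⟩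
        simp only [mem_filter] at hu hmax
        refine ⟨(v.1, u.2), ?_⟩
        simp only [mem_filter, and_true]
        exact mem_corners.2 ⟨u, hu.1, v, hv, hu.2,
          fun z hz hzz => (hmax z ⟨hz, hzz.2⟩).not_gt hzz.1, rfl, rfl⟩
      · rintro ⟨⟨i', j⟩, hv⟩
        simp only [mem_filter] at hv
        obtain ⟨hc, rfl⟩ := hv
        obtain ⟨u, hu, v, hv, huv, hz, rfl, rfl⟩ := mem_corners.1 hc
        exact ⟨v, by simp [hv]⟩
    omega

/-- The antichain with northernmost row `r`, westernmost column `c` and corner set `X`. -/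
def uncorner (X : Finset (ι × κ)) (r : ι) (c : κ) : Finset (ι × κ) :=
  (insert r (X.image Prod.fst) ×ˢ insert c (X.image Prod.snd)).filter fun a =>
    (a.1 = r ∨ ∃ b ∈ X, b.1 = a.1 ∧ a.2 < b.2) ∧
    (a.2 = c ∨ ∃ b ∈ X, b.2 = a.2 ∧ a.1 < b.1) ∧ ∀ b ∈ X, ¬(a.1 < b.1 ∧ a.2 < b.2)

variable {X : Finset (ι × κ)} {r : ι} {c : κ}

theorem mem_uncorner {a : ι × κ} : a ∈ uncorner X r c ↔
    (a.1 = r ∨ ∃ b ∈ X, b.1 = a.1 ∧ a.2 < b.2) ∧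
    (a.2 = c ∨ ∃ b ∈ X, b.2 = a.2 ∧ a.1 < b.1) ∧ ∀ b ∈ X, ¬(a.1 < b.1 ∧ a.2 < b.2) := by
  simp only [uncorner, mem_filter, and_iff_right_iff_imp, mem_product, mem_insert, mem_image]
  rintro ⟨h1, h2, -⟩
  exact ⟨h1.imp_right fun ⟨b, hb, h⟩ => ⟨b, hb, h.1⟩, h2.imp_right fun ⟨b, hb, h⟩ => ⟨b, hb, h.1⟩⟩

theorem le_fst_of_mem_uncorner (hr : ∀ b ∈ X, r < b.1) {a : ι × κ} (ha : a ∈ uncorner X r c) :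
    r ≤ a.1 := by
  rcases (mem_uncorner.1 ha).1 with h | ⟨b, hb, h, -⟩
  · exact h.ge
  · exact h ▸ (hr b hb).le

theorem le_snd_of_mem_uncorner (hc : ∀ b ∈ X, c < b.2) {a : ι × κ} (ha : a ∈ uncorner X r c) :
    c ≤ a.2 := by
  rcases (mem_uncorner.1 ha).2.1 with h | ⟨b, hb, h, -⟩
  · exact h.ge
  · exact h ▸ (hc b hb).le

theorem isAntichain_uncorner (hr : ∀ b ∈ X, r < b.1) (hc : ∀ b ∈ X, c < b.2) :
    IsAntichain (· ≤ ·) (uncorner X r c : Set (ι × κ)) := by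
  intro a ha a' ha' hne hle
  have hra := le_fst_of_mem_uncorner hr ha
  have hca := le_snd_of_mem_uncorner hc ha
  obtain ⟨-, -, h⟩ := mem_uncorner.1 ha
  obtain ⟨h1', h2', -⟩ := mem_uncorner.1 ha'
  refine hne (Prod.ext ?_ ?_)
  · refine hle.1.eq_of_not_lt fun hlt => ?_
    obtain ⟨b, hb, hb1, hb2⟩ := h1'.resolve_left (hra.trans_lt hlt).ne'
    exact h b hb ⟨hb1 ▸ hlt, hle.2.trans_lt hb2⟩
  · refine hle.2.eq_of_not_lt fun hlt => ?_
    obtain ⟨b, hb, hb1, hb2⟩ := h2'.resolve_left (hca.trans_lt hlt).ne'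
    exact h b hb ⟨hle.1.trans_lt hb2, hb1 ▸ hlt⟩

/-- The cells weakly southeast of some cell of `uncorner X r c`. -/
theorem exists_mem_uncorner_le_iff (hr : ∀ b ∈ X, r < b.1) (hc : ∀ b ∈ X, c < b.2) {x : ι × κ} :
    (∃ a ∈ uncorner X r c, a ≤ x) ↔
      r ≤ x.1 ∧ c ≤ x.2 ∧ ∀ b ∈ X, ¬(x.1 < b.1 ∧ x.2 < b.2) := by
  constructor
  · rintro ⟨a, ha, hax⟩
    exact ⟨(le_fst_of_mem_uncorner hr ha).trans hax.1, (le_snd_of_mem_uncorner hc ha).trans hax.2,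
      fun b hb h => (mem_uncorner.1 ha).2.2 b hb ⟨hax.1.trans_lt h.1, hax.2.trans_lt h.2⟩⟩
  · rintro ⟨h1, h2, h3⟩
    obtain ⟨r', hr1, hr2, hr3⟩ := exists_max_insert X Prod.fst r fun b => x.2 < b.2
    obtain ⟨c', hc1, hc2, hc3⟩ := exists_max_insert X Prod.snd c fun b => r' < b.1
    have hrx : r' ≤ x.1 := by
      rcases hr1 with h | ⟨b, hb, h, rfl⟩
      · exact h.le.trans h1
      · by_contra! h'
        exact h3 b hb ⟨h', h⟩
    have hcx : c' ≤ x.2 := by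
      rcases hc1 with h | ⟨b, hb, h, rfl⟩
      · exact h.le.trans h2
      · by_contra! h'
        exact (hr3 b hb h').not_gt h
    refine ⟨(r', c'), mem_uncorner.2 ⟨?_, ?_, fun b hb h => (hc3 b hb h.1).not_gt h.2⟩, hrx, hcx⟩
    · exact hr1.imp_right fun ⟨b, hb, h, h'⟩ => ⟨b, hb, h', hcx.trans_lt h⟩
    · exact hc1.imp_right fun ⟨b, hb, h, h'⟩ => ⟨b, hb, h', h⟩

theorem exists_mem_uncorner_fst_eq (hr : ∀ b ∈ X, r < b.1) : ∃ a ∈ uncorner X r c, a.1 = r := by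
  obtain ⟨c', hc1, hc2, hc3⟩ := exists_max_insert X Prod.snd c fun _ => True
  refine ⟨(r, c'), mem_uncorner.2 ⟨Or.inl rfl, ?_,
    fun b hb h => (hc3 b hb trivial).not_gt h.2⟩, rfl⟩
  exact hc1.imp_right fun ⟨b, hb, _, h⟩ => ⟨b, hb, h, hr b hb⟩

theorem exists_mem_uncorner_snd_eq (hc : ∀ b ∈ X, c < b.2) : ∃ a ∈ uncorner X r c, a.2 = c := by
  obtain ⟨r', hr1, hr2, hr3⟩ := exists_max_insert X Prod.fst r fun _ => True
  refine ⟨(r', c), mem_uncorner.2 ⟨?_, Or.inl rfl,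
    fun b hb h => (hr3 b hb trivial).not_gt h.1⟩, rfl⟩
  exact hr1.imp_right fun ⟨b, hb, _, h⟩ => ⟨b, hb, h, hc b hb⟩

theorem exists_mem_uncorner_fst_eq_of_mem (hX : IsAntichain (· ≤ ·) (X : Set (ι × κ)))
    (hc : ∀ b ∈ X, c < b.2) {b : ι × κ} (hb : b ∈ X) :
    ∃ a ∈ uncorner X r c, a.1 = b.1 := by
  obtain ⟨c', hc1, hc2, hc3⟩ := exists_max_insert X Prod.snd c fun b' => b.1 < b'.1
  refine ⟨(b.1, c'), mem_uncorner.2 ⟨Or.inr ⟨b, hb, rfl, ?_⟩, ?_,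
    fun b' hb' h => (hc3 b' hb' h.1).not_gt h.2⟩, rfl⟩
  · rcases hc1 with h | ⟨b', hb', h, h'⟩
    · exact h ▸ hc b hb
    · exact h'.symm.trans_lt (snd_lt_of_fst_lt hX hb hb' h)
  · exact hc1.imp_right fun ⟨b', hb', h, h'⟩ => ⟨b', hb', h', h⟩

theorem corners_uncorner (hX : IsAntichain (· ≤ ·) (X : Set (ι × κ)))
    (hr : ∀ b ∈ X, r < b.1) (hc : ∀ b ∈ X, c < b.2) : corners (uncorner X r c) = X := by
  have hY := isAntichain_uncorner hr hc
  ext ⟨i, j⟩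
  rw [mem_corners]
  constructor
  · rintro ⟨u, hu, v, hv, huv, hz, rfl, rfl⟩
    have hvu := snd_lt_of_fst_lt hY hu hv huv
    have hru := le_fst_of_mem_uncorner hr hu
    have hcv := le_snd_of_mem_uncorner hc hv
    obtain ⟨b, hb, hb1, hb2⟩ := (mem_uncorner.1 hv).1.resolve_left (hru.trans_lt huv).ne'
    obtain ⟨b', hb', hb1', hb2'⟩ := (mem_uncorner.1 hu).2.1.resolve_left (hcv.trans_lt hvu).ne'
    have hbu : b.2 ≤ u.2 := by
      by_contra! h
      exact (mem_uncorner.1 hu).2.2 b hb ⟨hb1 ▸ huv, h⟩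
    rcases hbu.eq_or_lt with h | h
    · rwa [← hb1, ← h]
    · have h' := fst_lt_of_snd_lt hX hb hb' (hb1' ▸ h)
      obtain ⟨w, hw, hwb⟩ := exists_mem_uncorner_fst_eq_of_mem (r := r) hX hc hb'
      exact absurd ⟨hwb ▸ hb2', by rw [hwb, ← hb1]; exact h'⟩ (hz w hw)
  · intro hb
    obtain ⟨r', hr1, hr2, hr3⟩ := exists_max_insert X Prod.fst r fun b' => j < b'.2
    obtain ⟨v, hv, hvi⟩ := exists_mem_uncorner_fst_eq_of_mem (r := r) hX hc hb
    have hri : r' < i := by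
      rcases hr1 with h | ⟨b', hb', h, h'⟩
      · exact h ▸ hr _ hb
      · rw [← h']; exact fst_lt_of_snd_lt hX hb hb' h
    refine ⟨(r', j), mem_uncorner.2 ⟨?_, Or.inr ⟨_, hb, rfl, hri⟩,
      fun b' hb' h => (hr3 b' hb' h.2).not_gt h.1⟩, v, hv, ?_, ?_, hvi, rfl⟩
    · exact hr1.imp_right fun ⟨b', hb', h, h'⟩ => ⟨b', hb', h', h⟩
    · rw [hvi]; exact hri
    · rintro w hw ⟨h1, h2⟩
      obtain ⟨b', hb', hb1, hb2⟩ := (mem_uncorner.1 hw).1.resolve_left (hr2.trans_lt h1).ne'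
      have h3 := snd_lt_of_fst_lt hX hb' hb (by rw [hb1]; exact h2.trans_eq hvi)
      exact (hr3 b' hb' h3).not_gt (hb1 ▸ h1)

end Antichains

variable {k p : ℕ} {A : Matrix (Fin k) (Fin p) ℕ}

theorem Ball.Before.cell_le {b b' : Ball A} (h : b'.Before b) : b'.1 ≤ b.1 :=
  Prod.mk_le_mk.2 ⟨h.1, h.2.1⟩

theorem Ball.not_before_self (b : Ball A) : ¬b.Before b := fun h => (h.2.2 rfl rfl).false

theorem Ball.before_of_cell_eq {c : Fin k × Fin p} {x y : Fin (A c.1 c.2)} (h : x < y) :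
    Ball.Before (A := A) ⟨c, x⟩ ⟨c, y⟩ :=
  ⟨le_rfl, le_rfl, fun _ _ => h⟩

theorem Ball.before_of_cell_lt {b b' : Ball A} (h : b'.1 ≤ b.1) (hne : b'.1 ≠ b.1) :
    b'.Before b :=
  ⟨h.1, h.2, fun h1 h2 => absurd (Prod.ext h1 h2) hne⟩

theorem Ball.Before.trans {a b c : Ball A} (h : a.Before b) (h' : b.Before c) : a.Before c := by
  refine ⟨h.1.trans h'.1, h.2.1.trans h'.2.1, fun h1 h2 => ?_⟩
  have h3 : a.row = b.row := le_antisymm h.1 (h1 ▸ h'.1)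
  have h4 : a.col = b.col := le_antisymm h.2.1 (h2 ▸ h'.2.1)
  exact (h.2.2 h3 h4).trans (h'.2.2 (h3 ▸ h1) (h4 ▸ h2))

theorem Ball.before_or_eq_or_before_of_cell_le {b b' : Ball A} (h : b'.1 ≤ b.1) :
    b'.Before b ∨ b' = b ∨ b.Before b' := by
  by_cases hne : b'.1 = b.1
  · obtain ⟨c, x⟩ := b
    obtain ⟨c', x'⟩ := b'
    obtain rfl : c' = c := hne
    rcases lt_trichotomy x' x with h | h | h
    · exact Or.inl (Ball.before_of_cell_eq h)
    · exact Or.inr (Or.inl (by rw [h]))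
    · exact Or.inr (Or.inr (Ball.before_of_cell_eq h))
  · exact Or.inl (Ball.before_of_cell_lt h hne)

theorem label_eq_sup (b : Ball A) :
    label b = ({b' | b'.Before b} : Finset (Ball A)).sup label + 1 := by
  rw [label, sup_attach _ (fun b' : Ball A => label b')]

theorem label_lt_label {b b' : Ball A} (h : b'.Before b) : label b' < label b := by
  rw [label_eq_sup b]
  exact Nat.lt_succ_of_le (le_sup (f := label) (by simpa using h))

theorem one_le_label (b : Ball A) : 1 ≤ label b := by
  rw [label_eq_sup]; omega

theorem exists_before_label_add_one_eq {b : Ball A} (h : label b ≠ 1) :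
    ∃ b' : Ball A, b'.Before b ∧ label b' + 1 = label b := by
  have hne : ({b' | b'.Before b} : Finset (Ball A)).Nonempty := by
    by_contra hne
    rw [not_nonempty_iff_eq_empty] at hne
    rw [label_eq_sup, hne] at h
    exact h rfl
  obtain ⟨b', hb', h'⟩ := exists_mem_eq_sup _ hne label
  exact ⟨b', by simpa using hb', by rw [label_eq_sup b, h']⟩

theorem wellFounded_before : WellFounded (Ball.Before (A := A)) := by
  refine Subrelation.wf (r := fun b' b => label b' < label b) ?_ (measure label).wf
  exact fun h => label_lt_label h

/-- The labelling is the only function on the balls with values at least `1` that increases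
strictly along `Before` and skips no value. -/
theorem label_eq_of {f : Ball A → ℕ} (h0 : ∀ b, 1 ≤ f b)
    (h1 : ∀ b b' : Ball A, b'.Before b → f b' < f b)
    (h2 : ∀ b, f b ≠ 1 → ∃ b' : Ball A, b'.Before b ∧ f b' + 1 = f b) (b : Ball A) :
    label b = f b := by
  induction b using wellFounded_before.induction with
  | _ b ih =>
  rw [label_eq_sup, sup_congr rfl (g := f) fun b' hb' => ih b' (by simpa using hb')]
  have hle : ({b' | b'.Before b} : Finset (Ball A)).sup f + 1 ≤ f b := by
    rw [Nat.add_one_le_iff, Finset.sup_lt_iff (h0 b)]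
    exact fun b' hb' => h1 _ _ (by simpa using hb')
  refine hle.antisymm ?_
  by_cases h : f b = 1
  · omega
  · obtain ⟨b', hb', h'⟩ := h2 b h
    rw [← h']
    exact Nat.add_le_add_right (le_sup (f := f) (by simpa using hb')) 1

theorem eq_of_label_eq_of_cell_le {b b' : Ball A} (h : label b' = label b) (hle : b'.1 ≤ b.1) :
    b' = b := by
  rcases Ball.before_or_eq_or_before_of_cell_le hle with h' | h' | h'
  · exact absurd h (label_lt_label h').ne
  · exact h'
  · exact absurd h (label_lt_label h').ne'

/-- The set of cells that contain a ball labelled `l`. -/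
def levelSet (A : Matrix (Fin k) (Fin p) ℕ) (l : ℕ) : Finset (Fin k × Fin p) :=
  ({b | label b = l} : Finset (Ball A)).image Sigma.fst

theorem mem_levelSet {l : ℕ} {c : Fin k × Fin p} :
    c ∈ levelSet A l ↔ ∃ b : Ball A, label b = l ∧ b.1 = c := by
  simp [levelSet]

theorem isAntichain_levelSet (l : ℕ) :
    IsAntichain (· ≤ ·) (levelSet A l : Set (Fin k × Fin p)) := by
  intro c hc c' hc' hne hle
  obtain ⟨b, hb, rfl⟩ := mem_levelSet.1 hc
  obtain ⟨b', hb', rfl⟩ := mem_levelSet.1 hc'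
  exact hne (congrArg Sigma.fst (eq_of_label_eq_of_cell_le (hb.trans hb'.symm) hle))

/-- The labels that occur in `A`. -/
def labels (A : Matrix (Fin k) (Fin p) ℕ) : Finset ℕ := (univ : Finset (Ball A)).image label

theorem mem_labels {l : ℕ} : l ∈ labels A ↔ ∃ b : Ball A, label b = l := by
  simp [labels]

theorem cornerMatrix_eq (l : ℕ) (i : Fin k) (j : Fin p) :
    cornerMatrix A l i j = if (i, j) ∈ corners (levelSet A l) then 1 else 0 := by
  unfold cornerMatrix
  refine if_congr ?_ rfl rfl
  rw [mem_corners]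
  constructor
  · rintro ⟨b, b', ⟨h1, h2, h3, h4⟩, h5, h6⟩
    refine ⟨b.1, mem_levelSet.2 ⟨b, h1, rfl⟩, b'.1, mem_levelSet.2 ⟨b', h2, rfl⟩, h3, ?_, h5, h6⟩
    intro z hz
    obtain ⟨c, hc, rfl⟩ := mem_levelSet.1 hz
    exact h4 c hc
  · rintro ⟨u, hu, v, hv, h3, h4, h5, h6⟩
    obtain ⟨b, hb, rfl⟩ := mem_levelSet.1 hu
    obtain ⟨b', hb', rfl⟩ := mem_levelSet.1 hv
    exact ⟨b, b', ⟨hb, hb', h3, fun c hc => h4 c.1 (mem_levelSet.2 ⟨c, hc, rfl⟩)⟩, h5, h6⟩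

theorem nextMatrix_apply (i : Fin k) (j : Fin p) :
    nextMatrix A i j = #{l ∈ labels A | (i, j) ∈ corners (levelSet A l)} := by
  rw [nextMatrix, Matrix.sum_apply, card_filter]
  exact sum_congr rfl fun l _ => cornerMatrix_eq l i j

theorem apply_eq_card_labels (i : Fin k) (j : Fin p) :
    A i j = #{l ∈ labels A | (i, j) ∈ levelSet A l} := by
  have : ({l ∈ labels A | (i, j) ∈ levelSet A l} : Finset ℕ) =
      (univ : Finset (Fin (A i j))).image fun x => label (A := A) ⟨(i, j), x⟩ := by
    ext l
    simp only [mem_filter, mem_labels, mem_levelSet, mem_image, mem_univ, true_and]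
    constructor
    · rintro ⟨-, ⟨c, x⟩, hb, rfl⟩
      exact ⟨x, hb⟩
    · rintro ⟨x, rfl⟩
      exact ⟨⟨_, rfl⟩, ⟨_, rfl, rfl⟩⟩
  rw [this, card_image_of_injective, card_univ, Fintype.card_fin]
  intro x y hxy
  have := eq_of_label_eq_of_cell_le hxy le_rfl
  simpa using this

/-- The row sums of a sum of indicator matrices. -/
theorem rowVec_eq_sum_card {σ : Type*} {s : Finset σ} {T : σ → Finset (Fin k × Fin p)}
    (h : ∀ i j, A i j = #{l ∈ s | (i, j) ∈ T l}) (i : Fin k) :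
    rowVec A i = ∑ l ∈ s, #{a ∈ T l | a.1 = i} := by
  have hT : ∀ l, #{a ∈ T l | a.1 = i} = ∑ j, if (i, j) ∈ T l then 1 else 0 := fun l => by
    rw [← card_filter]
    refine card_bij' (fun a _ => a.2) (fun j _ => (i, j)) ?_ ?_ ?_ ?_
    · rintro ⟨a, b⟩ h
      simp only [mem_filter] at h
      obtain ⟨h, rfl⟩ := h
      simpa using h
    · simp
    · rintro ⟨a, b⟩ h
      simp only [mem_filter] at h
      rw [← h.2]
    · simp
  simp only [rowVec, h, hT, card_filter]
  exact sum_comm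

/-- Along a family of antichains, the row sums of the matrix and of its matrix of corners differ
by the numbers of antichains with given northernmost row. -/
theorem rowVec_eq_add_card {σ : Type*} {s : Finset σ} {T : σ → Finset (Fin k × Fin p)}
    {C : Matrix (Fin k) (Fin p) ℕ} {r : σ → Fin k}
    (hT : ∀ l ∈ s, IsAntichain (· ≤ ·) (T l : Set (Fin k × Fin p)))
    (hA : ∀ i j, A i j = #{l ∈ s | (i, j) ∈ T l})
    (hC : ∀ i j, C i j = #{l ∈ s | (i, j) ∈ corners (T l)})
    (hr : ∀ l ∈ s, ∀ a ∈ T l, r l ≤ a.1) (hr' : ∀ l ∈ s, ∃ a ∈ T l, a.1 = r l) (i : Fin k) :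
    rowVec A i = rowVec C i + #{l ∈ s | r l = i} := by
  rw [rowVec_eq_sum_card hA, rowVec_eq_sum_card hC, card_filter, ← sum_add_distrib]
  exact sum_congr rfl fun l hl => card_row_eq (hT l hl) (hr l hl) (hr' l hl) i

/-- A matrix that counts, cell by cell, the elements of finite sets `L c` of a linear order: its
balls can be numbered by the elements of these sets, increasingly in each cell. -/
theorem exists_numbering {σ : Type*} [LinearOrder σ] {L : Fin k × Fin p → Finset σ}
    (h : ∀ i j, A i j = #(L (i, j))) :
    ∃ φ : Ball A → σ, (∀ b, φ b ∈ L b.1) ∧ (∀ c, ∀ l ∈ L c, ∃ b : Ball A, b.1 = c ∧ φ b = l) ∧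
      ∀ b b' : Ball A, b.1 = b'.1 → (φ b < φ b' ↔ b.pos < b'.pos) := by
  have hc : ∀ c : Fin k × Fin p, #(L c) = A c.1 c.2 := fun c => (h c.1 c.2).symm
  refine ⟨fun b => (L b.1).orderEmbOfFin (hc b.1) b.2, fun b => orderEmbOfFin_mem _ _ _, ?_, ?_⟩
  · intro c l hl
    have : l ∈ Set.range ((L c).orderEmbOfFin (hc c)) := by rwa [range_orderEmbOfFin]
    obtain ⟨x, rfl⟩ := this
    exact ⟨⟨c, x⟩, rfl, rfl⟩
  · rintro ⟨c, x⟩ ⟨c', x'⟩ hcc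
    obtain rfl : c = c' := hcc
    exact OrderEmbedding.lt_iff_lt _

/-- The ball of the transposed matrix that corresponds to a ball of `A`. -/
def Ball.transpose (b : Ball A) : Ball A.transpose := ⟨b.1.swap, b.2⟩

/-- Transposition as a bijection between the balls of `A` and of its transpose. -/
def ballTranspose (A : Matrix (Fin k) (Fin p) ℕ) : Ball A ≃ Ball A.transpose where
  toFun := Ball.transpose
  invFun := Ball.transpose (A := A.transpose)
  left_inv _ := rfl
  right_inv _ := rfl

theorem Ball.transpose_before {b b' : Ball A} : b'.transpose.Before b.transpose ↔ b'.Before b :=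
  ⟨fun h => ⟨h.2.1, h.1, fun h1 h2 => h.2.2 h2 h1⟩,
    fun h => ⟨h.2.1, h.1, fun h1 h2 => h.2.2 h2 h1⟩⟩

theorem label_transpose (b : Ball A) : label b.transpose = label b := by
  refine (label_eq_of (f := fun b : Ball A => label b.transpose) (fun b => one_le_label _)
    (fun b b' h => label_lt_label (Ball.transpose_before.2 h)) (fun b h => ?_) b).symm
  obtain ⟨b', hb', h'⟩ := exists_before_label_add_one_eq h
  exact ⟨(ballTranspose A).symm b', Ball.transpose_before.1 hb', h'⟩

theorem levelSet_transpose (l : ℕ) :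
    levelSet A.transpose l = (levelSet A l).map (Equiv.prodComm _ _).toEmbedding := by
  ext ⟨j, i⟩
  simp only [mem_levelSet, mem_map_equiv, Equiv.prodComm_symm, Equiv.prodComm_apply,
    Prod.swap_prod_mk]
  constructor
  · rintro ⟨b, rfl, h⟩
    exact ⟨(ballTranspose A).symm b, (label_transpose _).symm, congrArg Prod.swap h⟩
  · rintro ⟨b, rfl, h⟩
    exact ⟨b.transpose, label_transpose _, congrArg Prod.swap h⟩

theorem labels_transpose : labels A.transpose = labels A := by
  ext l
  simp only [mem_labels]
  constructor
  · rintro ⟨b, rfl⟩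
    exact ⟨(ballTranspose A).symm b, (label_transpose _).symm⟩
  · rintro ⟨b, rfl⟩
    exact ⟨b.transpose, label_transpose _⟩

theorem nextMatrix_transpose : nextMatrix A.transpose = (nextMatrix A).transpose := by
  ext j i
  rw [Matrix.transpose_apply, nextMatrix_apply, nextMatrix_apply, labels_transpose]
  simp only [levelSet_transpose, swap_mem_corners_map_swap (isAntichain_levelSet _)]

theorem westernCount_eq (j : Fin p) : westernCount A j = northernCount A.transpose j := by
  refine card_equiv (ballTranspose A) fun b => ?_
  simp only [mem_filter, mem_univ, true_and]
  refine and_congr ⟨fun h b' hb' => ?_, fun h b' hb' => ?_⟩ Iff.rfl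
  · refine h ((ballTranspose A).symm b') ?_
    rw [← label_transpose, ← label_transpose b]
    exact hb'
  · exact h b'.transpose ((label_transpose b').trans (hb'.trans (label_transpose b).symm))

theorem eq_of_isNorthern {b b' : Ball A} (hb : IsNorthern b) (hb' : IsNorthern b')
    (h : label b = label b') : b = b' := by
  have hrow : b.1.1 = b'.1.1 := le_antisymm (hb b' h.symm) (hb' b h)
  rcases le_total b.1.2 b'.1.2 with hc | hc
  · exact eq_of_label_eq_of_cell_le h (Prod.mk_le_mk.2 ⟨hrow.le, hc⟩)
  · exact (eq_of_label_eq_of_cell_le h.symm (Prod.mk_le_mk.2 ⟨hrow.ge, hc⟩)).symm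

theorem exists_isNorthern (b : Ball A) : ∃ b' : Ball A, IsNorthern b' ∧ label b' = label b := by
  obtain ⟨b', hb', h⟩ := exists_min_image ({c | label c = label b} : Finset (Ball A)) Ball.row
    ⟨b, by simp⟩
  simp only [mem_filter, mem_univ, true_and] at hb' h
  exact ⟨b', fun c hc => h c (hc.trans hb'), hb'⟩

/-- The labels that occur in the rows up to `i`. -/
def labelsIic (A : Matrix (Fin k) (Fin p) ℕ) (i : Fin k) : Finset ℕ :=
  ({b | b.row ≤ i} : Finset (Ball A)).image label

theorem mem_labelsIic {i : Fin k} {l : ℕ} :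
    l ∈ labelsIic A i ↔ ∃ b : Ball A, b.row ≤ i ∧ label b = l := by
  simp [labelsIic]

theorem sum_northernCount (i : Fin k) :
    ∑ q ∈ Iic i, northernCount A q = #(labelsIic A i) := by
  have h1 : ∑ q ∈ Iic i, northernCount A q =
      #({b | IsNorthern b ∧ b.row ≤ i} : Finset (Ball A)) := by
    rw [card_eq_sum_card_fiberwise (f := Ball.row) (t := Iic i)]
    · refine sum_congr rfl fun q hq => ?_
      rw [northernCount, filter_filter]
      congr 1
      ext b
      simp only [mem_filter, mem_univ, true_and]
      rw [mem_Iic] at hq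
      exact ⟨fun h => ⟨⟨h.1, h.2 ▸ hq⟩, h.2⟩, fun h => ⟨h.1.1, h.2⟩⟩
    · intro b hb
      simpa using (mem_filter.1 hb).2.2
  rw [h1]
  refine card_bij (fun b _ => label b) ?_ ?_ ?_
  · intro b hb
    simp only [mem_filter, mem_univ, true_and] at hb
    exact mem_labelsIic.2 ⟨b, hb.2, rfl⟩
  · intro b hb b' hb' h
    simp only [mem_filter, mem_univ, true_and] at hb hb'
    exact eq_of_isNorthern hb.1 hb'.1 h
  · intro l hl
    obtain ⟨b, hb, rfl⟩ := mem_labelsIic.1 hl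
    obtain ⟨b', hb', h⟩ := exists_isNorthern b
    exact ⟨b', by simpa using ⟨hb', (hb' b h.symm).trans hb⟩, h⟩

/-- Every ball ends a chain of balls whose length is its label. -/
theorem exists_chain (b : Ball A) : ∃ s : Finset (Ball A), #s = label b ∧
    (∀ x ∈ s, x = b ∨ x.Before b) ∧ ∀ x ∈ s, ∀ y ∈ s, x ≠ y → x.Before y ∨ y.Before x := by
  classical
  induction b using wellFounded_before.induction with
  | _ b ih =>
  by_cases h : label b = 1
  · refine ⟨{b}, by simp [h], by simp, ?_⟩
    intro x hx y hy hne
    rw [mem_singleton] at hx hy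
    exact absurd (hx.trans hy.symm) hne
  · obtain ⟨b', hb', h'⟩ := exists_before_label_add_one_eq h
    obtain ⟨s, hs1, hs2, hs3⟩ := ih b' hb'
    have hbefore : ∀ x ∈ s, x.Before b := fun x hx => by
      rcases hs2 x hx with rfl | h
      · exact hb'
      · exact h.trans hb'
    refine ⟨insert b s, ?_, ?_, ?_⟩
    · rw [card_insert_of_notMem fun hb => Ball.not_before_self b (hbefore b hb), hs1, h']
    · intro x hx
      exact (mem_insert.1 hx).imp_right (hbefore x)
    · intro x hx y hy hne
      rcases mem_insert.1 hx with rfl | hx' <;> rcases mem_insert.1 hy with rfl | hy'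
      · exact absurd rfl hne
      · exact Or.inr (hbefore y hy')
      · exact Or.inl (hbefore x hx')
      · exact hs3 x hx' y hy' hne

/-- The labels of the balls in the rows up to `i` form an initial segment. -/
theorem card_labelsIic_le (i : Fin k) :
    #(labelsIic A i) = 0 ∨ ∃ b : Ball A, b.row ≤ i ∧ #(labelsIic A i) ≤ label b := by
  rcases (labelsIic A i).eq_empty_or_nonempty with h | h
  · exact Or.inl (by rw [h, card_empty])
  · obtain ⟨b, hb, hmax⟩ := mem_labelsIic.1 (max'_mem _ h)
    refine Or.inr ⟨b, hb, ?_⟩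
    have hsub : labelsIic A i ⊆ Icc 1 (label b) := fun l hl => by
      obtain ⟨b', hb', rfl⟩ := mem_labelsIic.1 hl
      exact mem_Icc.2 ⟨one_le_label b', hmax ▸ le_max' _ _ hl⟩
    simpa using card_le_card hsub

theorem label_le_card_labelsIic (b : Ball A) : label b ≤ #(labelsIic A b.row) := by
  have h : ∀ n, ∀ b : Ball A, label b = n → Icc 1 n ⊆ labelsIic A b.row := by
    intro n
    induction n with
    | zero => intro b _; simp
    | succ n ih =>
      intro b hb l hl
      rw [mem_Icc] at hl
      by_cases hln : l = n + 1
      · exact mem_labelsIic.2 ⟨b, le_rfl, hb.trans hln.symm⟩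
      · obtain ⟨b', hb', h'⟩ := exists_before_label_add_one_eq (b := b) (by omega)
        have := ih b' (by omega) (mem_Icc.2 ⟨hl.1, by omega⟩)
        obtain ⟨c, hc, hcl⟩ := mem_labelsIic.1 this
        exact mem_labelsIic.2 ⟨c, hc.trans hb'.1, hcl⟩
  simpa using card_le_card (h _ b rfl)

theorem card_filter_coe_sort {σ : Type*} (s : Finset σ) (P : σ → Prop) [DecidablePred P] :
    #{l : s | P l} = #{l ∈ s | P l} := by
  rw [← card_map (Function.Embedding.subtype _)]
  congr 1
  ext l
  simp [and_comm]

theorem sum_card_fiber_Iio {σ : Type*} [Fintype σ] (r : σ → Fin k) (i : Fin k) :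
    ∑ q ∈ Iio i, #{l | r l = q} = #{l | r l < i} := by
  rw [card_eq_sum_card_fiberwise (f := r) (t := Iio i)]
  · refine sum_congr rfl fun q hq => ?_
    rw [filter_filter]
    congr 1
    ext l
    simp only [mem_filter, mem_univ, true_and]
    rw [mem_Iio] at hq
    exact ⟨fun h => ⟨h ▸ hq, h⟩, fun h => h.2⟩
  · intro l hl
    simpa using hl

/-- A necessary condition on the northern balls of `nextMatrix A`. -/
theorem sum_northernCount_nextMatrix_le (i : Fin k) :
    ∑ q ∈ Iic i, (northernCount (nextMatrix A) q : ℤ) ≤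
      ∑ q ∈ Iio i, ((rowVec A q : ℤ) - rowVec (nextMatrix A) q) := by
  have hmin : ∀ l : labels A, ∃ r : Fin k, (∀ a ∈ levelSet A l, r ≤ a.1) ∧
      ∃ a ∈ levelSet A l, a.1 = r := by
    rintro ⟨l, hl⟩
    obtain ⟨b, hb⟩ := mem_labels.1 hl
    obtain ⟨a, ha, h⟩ := exists_min_image (levelSet A l) Prod.fst
      ⟨b.1, mem_levelSet.2 ⟨b, hb, rfl⟩⟩
    exact ⟨a.1, h, a, ha, rfl⟩
  choose r hr hr' using hmin
  have hA : ∀ i j, A i j = #{l : labels A | (i, j) ∈ levelSet A l} := fun i j =>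
    (apply_eq_card_labels i j).trans
      (card_filter_coe_sort (labels A) fun l => (i, j) ∈ levelSet A l).symm
  have hC : ∀ i j, nextMatrix A i j = #{l : labels A | (i, j) ∈ corners (levelSet A l)} :=
    fun i j => (nextMatrix_apply i j).trans
      (card_filter_coe_sort (labels A) fun l => (i, j) ∈ corners (levelSet A l)).symm
  have hrow : ∀ q, (rowVec A q : ℤ) - rowVec (nextMatrix A) q =
      #{l : labels A | r l = q} := fun q => by
    rw [rowVec_eq_add_card (C := nextMatrix A) (s := univ) (T := fun l : labels A => levelSet A l)
      (r := r) (fun l _ => isAntichain_levelSet _) hA hC (fun l _ => hr l) (fun l _ => hr' l)]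
    push_cast; ring
  simp only [hrow]
  norm_cast
  rw [sum_northernCount, sum_card_fiber_Iio]
  rcases card_labelsIic_le (A := nextMatrix A) i with h | ⟨b, hb, hle⟩
  · omega
  refine hle.trans ?_
  obtain ⟨s, hs, hs1, hs2⟩ := exists_chain b
  obtain ⟨φ, hφ, -, hφ2⟩ := exists_numbering (A := nextMatrix A)
    (L := fun c => {l : labels A | c ∈ corners (levelSet A l.1)}) hC
  simp only [mem_filter, mem_univ, true_and] at hφ
  rw [← hs]
  refine card_le_card_of_injOn φ ?_ ?_
  · intro x hx
    have hxi : x.row ≤ i := by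
      rcases hs1 x hx with rfl | h
      · exact hb
      · exact h.1.trans hb
    obtain ⟨u, hu, v, hv, huv, -, hvx, -⟩ := mem_corners.1 (hφ x)
    simp only [coe_filter, mem_univ, true_and, Set.mem_ofPred_eq]
    exact ((hr (φ x) u hu).trans_lt huv).trans_le (hvx.trans_le hxi)
  · have hlt : ∀ x y : Ball (nextMatrix A), x.Before y → φ x ≠ φ y := fun x y hxy h => by
      have hx := hφ x
      rw [h] at hx
      have hcell := (isAntichain_corners (isAntichain_levelSet _)).eq hx (hφ y) hxy.cell_le
      exact ((hφ2 x y hcell).2 (hxy.2.2 (congrArg Prod.fst hcell) (congrArg Prod.snd hcell))).ne h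
    intro x hx y hy hxy
    by_contra hne
    rcases hs2 x hx y hy hne with h | h
    · exact hlt x y h hxy
    · exact hlt y x h hxy.symm

variable {B : Matrix (Fin k) (Fin p) ℕ}

/-- A family of antichains with nested shadows is the family of level sets of its sum. -/
theorem label_of_nested {m : ℕ} {T : Fin m → Finset (Fin k × Fin p)}
    (hA : ∀ i j, A i j = #{l | (i, j) ∈ T l})
    (hT : ∀ l, IsAntichain (· ≤ ·) (T l : Set (Fin k × Fin p)))
    (hnest : ∀ l l' : Fin m, (l : ℕ) + 1 = l' → ∀ a ∈ T l', ∃ a' ∈ T l, a' ≤ a) :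
    (∀ b : Ball A, ∃ l : Fin m, label b = l + 1) ∧ ∀ l : Fin m, levelSet A (l + 1) = T l := by
  have hnest' : ∀ d : ℕ, ∀ l l' : Fin m, (l : ℕ) + d = l' → ∀ a ∈ T l', ∃ a' ∈ T l, a' ≤ a := by
    intro d
    induction d with
    | zero =>
      intro l l' h a ha
      obtain rfl : l = l' := Fin.ext h
      exact ⟨a, ha, le_rfl⟩
    | succ d ih =>
      intro l l' h a ha
      obtain ⟨a', ha', h'⟩ := hnest ⟨l + d, by omega⟩ l' (by simp only; omega) a ha
      obtain ⟨a'', ha'', h''⟩ := ih l _ rfl a' ha'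
      exact ⟨a'', ha'', h''.trans h'⟩
  obtain ⟨φ, hφ1, hφ2, hφ3⟩ := exists_numbering (A := A)
    (L := fun c => {l : Fin m | c ∈ T l}) hA
  simp only [mem_filter, mem_univ, true_and] at hφ1 hφ2
  have hlabel : ∀ b, label b = (φ b : ℕ) + 1 := by
    refine label_eq_of (fun b => by omega) (fun b b' h => ?_) (fun b hb => ?_)
    · rw [Nat.add_lt_add_iff_right, ← Fin.lt_def]
      by_contra! hle
      obtain ⟨a, ha, hab⟩ := hnest' (φ b' - φ b) (φ b) (φ b')
        (by rw [Fin.le_def] at hle; omega) b'.1 (hφ1 b')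
      have hcell : b'.1 = b.1 :=
        h.cell_le.antisymm (((hT _).eq ha (hφ1 b) (hab.trans h.cell_le)) ▸ hab)
      exact hle.not_gt ((hφ3 b' b hcell).2
        (h.2.2 (congrArg Prod.fst hcell) (congrArg Prod.snd hcell)))
    · have hlt := (φ b).isLt
      obtain ⟨a, ha, hab⟩ := hnest ⟨φ b - 1, by omega⟩ (φ b) (by simp only; omega) b.1 (hφ1 b)
      obtain ⟨b', rfl, hb'⟩ := hφ2 a _ ha
      have hval : (φ b' : ℕ) + 1 = φ b := by rw [hb']; simp only; omega
      refine ⟨b', ?_, by omega⟩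
      by_cases hcell : b'.1 = b.1
      · exact ⟨hab.1, hab.2, fun _ _ => (hφ3 b' b hcell).1 (Fin.lt_def.2 (by omega))⟩
      · exact Ball.before_of_cell_lt hab hcell
  refine ⟨fun b => ⟨φ b, hlabel b⟩, fun l => ?_⟩
  ext c
  rw [mem_levelSet]
  constructor
  · rintro ⟨b, hb, rfl⟩
    obtain rfl : φ b = l := Fin.ext (by have := hlabel b; omega)
    exact hφ1 b
  · intro hc
    obtain ⟨b, rfl, rfl⟩ := hφ2 c l hc
    exact ⟨b, hlabel b, rfl⟩

theorem nextMatrix_of_nested {m : ℕ} {T : Fin m → Finset (Fin k × Fin p)}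
    (hA : ∀ i j, A i j = #{l | (i, j) ∈ T l})
    (hT : ∀ l, IsAntichain (· ≤ ·) (T l : Set (Fin k × Fin p)))
    (hnest : ∀ l l' : Fin m, (l : ℕ) + 1 = l' → ∀ a ∈ T l', ∃ a' ∈ T l, a' ≤ a)
    (i : Fin k) (j : Fin p) : nextMatrix A i j = #{l | (i, j) ∈ corners (T l)} := by
  obtain ⟨h1, h2⟩ := label_of_nested hA hT hnest
  rw [nextMatrix_apply]
  symm
  refine card_bij (fun l _ => (l : ℕ) + 1) (fun l hl => ?_)
    (fun l _ l' _ h => Fin.ext (by omega)) (fun l hl => ?_)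
  · simp only [mem_filter, mem_univ, true_and] at hl
    rw [mem_filter, h2]
    refine ⟨?_, hl⟩
    obtain ⟨u, hu, -⟩ := mem_corners.1 hl
    rw [← h2] at hu
    obtain ⟨b, hb, -⟩ := mem_levelSet.1 hu
    exact mem_labels.2 ⟨b, hb⟩
  · rw [mem_filter, mem_labels] at hl
    obtain ⟨⟨b, rfl⟩, hl⟩ := hl
    obtain ⟨l, hb⟩ := h1 b
    rw [hb, h2] at hl
    exact ⟨l, by simpa using hl, hb.symm⟩

theorem colVec_eq_add_card {σ : Type*} {s : Finset σ} {T : σ → Finset (Fin k × Fin p)}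
    {C : Matrix (Fin k) (Fin p) ℕ} {c : σ → Fin p}
    (hT : ∀ l ∈ s, IsAntichain (· ≤ ·) (T l : Set (Fin k × Fin p)))
    (hA : ∀ i j, A i j = #{l ∈ s | (i, j) ∈ T l})
    (hC : ∀ i j, C i j = #{l ∈ s | (i, j) ∈ corners (T l)})
    (hc : ∀ l ∈ s, ∀ a ∈ T l, c l ≤ a.2) (hc' : ∀ l ∈ s, ∃ a ∈ T l, a.2 = c l) (j : Fin p) :
    colVec A j = colVec C j + #{l ∈ s | c l = j} := by
  refine rowVec_eq_add_card (A := A.transpose) (C := C.transpose)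
    (T := fun l => (T l).map (Equiv.prodComm _ _).toEmbedding)
    (fun l hl => isAntichain_map_swap (hT l hl)) (fun j i => ?_) (fun j i => ?_)
    (fun l hl a ha => ?_) (fun l hl => ?_) j
  · rw [Matrix.transpose_apply, hA]
    congr 1
    ext l
    simp [mem_map_equiv]
  · rw [Matrix.transpose_apply, hC]
    congr 1
    refine filter_congr fun l hl => (swap_mem_corners_map_swap (hT l hl)).symm
  · rw [mem_map_equiv] at ha
    exact hc l hl _ ha
  · obtain ⟨a, ha, h⟩ := hc' l hl
    exact ⟨a.swap, by simpa [mem_map_equiv] using ha, h⟩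

/-- Every vector of multiplicities is realised by a weakly increasing sequence. -/
theorem exists_monotone_card_fiber {m : ℕ} (a : Fin k → ℕ) (h : ∑ i, a i = m) :
    ∃ r : Fin m → Fin k, Monotone r ∧ ∀ i, #{l | r l = i} = a i := by
  let e : Fin m ≃ Σ i, Fin (a i) := (Fintype.equivFinOfCardEq (by simp [h])).symm
  let g : Fin m → Fin k := fun l => (e l).1
  refine ⟨g ∘ Tuple.sort g, Tuple.monotone_sort g, fun i => ?_⟩
  rw [← Fintype.card_fin (a i), ← card_univ]
  symm
  refine card_bij (fun x _ => (Tuple.sort g).symm (e.symm ⟨i, x⟩)) ?_ ?_ ?_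
  · simp [g]
  · intro x _ y _ hxy
    simpa using hxy
  · intro l hl
    simp only [Function.comp_apply, mem_filter, mem_univ, true_and] at hl
    subst hl
    exact ⟨(e (Tuple.sort g l)).2, mem_univ _, by simp [g]⟩

theorem row_lt_of_northern_le {m : ℕ} {r : Fin m → Fin k} (hr : Monotone r)
    (h : ∀ i, ∑ q ∈ Iic i, northernCount B q ≤ ∑ q ∈ Iio i, #{l | r l = q}) (b : Ball B) :
    ∃ l : Fin m, (l : ℕ) + 1 = label b ∧ r l < b.row := by
  have h1 := h b.row
  rw [sum_northernCount, sum_card_fiber_Iio] at h1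
  have h2 := (label_le_card_labelsIic b).trans h1
  have h3 := one_le_label b
  by_contra! hcon
  have hsub : ({l | r l < b.row} : Finset (Fin m)).map Fin.valEmbedding ⊆
      range (label b - 1) := by
    intro x hx
    simp only [mem_map, mem_filter, mem_univ, true_and, Fin.valEmbedding_apply] at hx
    obtain ⟨l, hl, rfl⟩ := hx
    rw [mem_range]
    by_contra! hle
    have hlt := l.isLt
    have := hcon ⟨label b - 1, by omega⟩ (by simp only; omega)
    exact (this.trans (hr (Fin.le_def.2 hle))).not_gt hl
  have := card_le_card hsub
  rw [card_map, card_range] at this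
  omega

/-- If the balls can be numbered compatibly with the bounds `r` and `c`, then there is a
numbering that cannot be increased at any ball. -/
theorem exists_maximal_numbering {m : ℕ} {r : Fin m → Fin k} {c : Fin m → Fin p}
    {ℓ₀ : Ball B → Fin m} (hr : ∀ b, r (ℓ₀ b) < b.row) (hc : ∀ b, c (ℓ₀ b) < b.col)
    (hlt : ∀ b b' : Ball B, b.Before b' → ℓ₀ b < ℓ₀ b') :
    ∃ ℓ : Ball B → Fin m, (∀ b, r (ℓ b) < b.row) ∧ (∀ b, c (ℓ b) < b.col) ∧
      (∀ b b' : Ball B, b.Before b' → ℓ b < ℓ b') ∧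
      ∀ b (l : Fin m), (ℓ b : ℕ) + 1 = l → r l < b.row → c l < b.col → ∃ b', b.Before b' ∧ ℓ b' = l := by
  classical
  obtain ⟨ℓ, hℓ, hmax⟩ := exists_max_image
    ({ℓ | (∀ b, r (ℓ b) < b.row) ∧ (∀ b, c (ℓ b) < b.col) ∧
      ∀ b b' : Ball B, b.Before b' → ℓ b < ℓ b'} : Finset (Ball B → Fin m))
    (fun ℓ => ∑ b, (ℓ b : ℕ)) ⟨ℓ₀, by simpa using ⟨hr, hc, hlt⟩⟩
  simp only [mem_filter, mem_univ, true_and] at hℓ hmax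
  obtain ⟨h1, h2, h3⟩ := hℓ
  refine ⟨ℓ, h1, h2, h3, fun b l hl hrl hcl => ?_⟩
  by_contra! hcon
  have hℓl : ℓ b < l := Fin.lt_def.2 (by omega)
  refine (hmax (Function.update ℓ b l) ⟨fun x => ?_, fun x => ?_, fun x y hxy => ?_⟩).not_gt ?_
  · by_cases hx : x = b
    · subst hx; simpa using hrl
    · simpa [hx] using h1 x
  · by_cases hx : x = b
    · subst hx; simpa using hcl
    · simpa [hx] using h2 x
  · by_cases hx : x = b
    · subst hx
      have hy : y ≠ x := fun h => Ball.not_before_self x (h ▸ hxy)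
      rw [Function.update_self, Function.update_of_ne hy]
      have := hcon y hxy
      have h4 := h3 x y hxy
      rw [Fin.lt_def] at h4 ⊢
      have : (ℓ y : ℕ) ≠ l := fun h => this (Fin.ext h)
      omega
    · rw [Function.update_of_ne hx]
      by_cases hy : y = b
      · subst hy
        rw [Function.update_self]
        exact (h3 x y hxy).trans hℓl
      · rw [Function.update_of_ne hy]
        exact h3 x y hxy
  · refine sum_lt_sum (fun x _ => ?_) ⟨b, mem_univ b, by simpa using hℓl⟩
    by_cases hx : x = b
    · subst hx; simpa using hℓl.le
    · simp [hx]

/-- The inverse of the matrix-ball construction. -/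
theorem exists_nextMatrix_eq {m : ℕ} {r : Fin m → Fin k} {c : Fin m → Fin p}
    (hr : Monotone r) (hc : Monotone c)
    (hnorth : ∀ i, ∑ q ∈ Iic i, northernCount B q ≤ ∑ q ∈ Iio i, #{l | r l = q})
    (hwest : ∀ j, ∑ q ∈ Iic j, westernCount B q ≤ ∑ q ∈ Iio j, #{l | c l = q}) :
    ∃ A : Matrix (Fin k) (Fin p) ℕ, nextMatrix A = B ∧
      (∀ i, rowVec A i = rowVec B i + #{l | r l = i}) ∧
      ∀ j, colVec A j = colVec B j + #{l | c l = j} := by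
  choose ℓ₀ hℓ₀ hrℓ₀ using row_lt_of_northern_le hr hnorth
  have hcℓ₀ : ∀ b, c (ℓ₀ b) < b.col := fun b => by
    simp only [westernCount_eq] at hwest
    obtain ⟨l, hl, hlt⟩ := row_lt_of_northern_le hc hwest b.transpose
    rw [label_transpose, ← hℓ₀] at hl
    obtain rfl : l = ℓ₀ b := Fin.ext (by omega)
    exact hlt
  obtain ⟨ℓ, h1, h2, h3, h4⟩ := exists_maximal_numbering hrℓ₀ hcℓ₀ fun b b' h => by
    have := label_lt_label h
    rw [← hℓ₀, ← hℓ₀] at this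
    exact Fin.lt_def.2 (by omega)
  let X : Fin m → Finset (Fin k × Fin p) := fun l =>
    ({b | ℓ b = l} : Finset (Ball B)).image Sigma.fst
  have memX : ∀ l a, a ∈ X l ↔ ∃ b : Ball B, ℓ b = l ∧ b.1 = a := fun l a => by simp [X]
  have heq : ∀ b b' : Ball B, ℓ b = ℓ b' → b.1 ≤ b'.1 → b = b' := fun b b' h hle => by
    rcases Ball.before_or_eq_or_before_of_cell_le hle with h' | h' | h'
    · exact absurd h (h3 _ _ h').ne
    · exact h'
    · exact absurd h (h3 _ _ h').ne'
  have hX : ∀ l, IsAntichain (· ≤ ·) (X l : Set (Fin k × Fin p)) := by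
    intro l a ha a' ha' hne hle
    obtain ⟨b, hb, rfl⟩ := (memX _ _).1 ha
    obtain ⟨b', hb', rfl⟩ := (memX _ _).1 ha'
    exact hne (congrArg Sigma.fst (heq _ _ (hb.trans hb'.symm) hle))
  have hrX : ∀ l, ∀ b ∈ X l, r l < b.1 := fun l a ha => by
    obtain ⟨b, rfl, rfl⟩ := (memX _ _).1 ha
    exact h1 b
  have hcX : ∀ l, ∀ b ∈ X l, c l < b.2 := fun l a ha => by
    obtain ⟨b, rfl, rfl⟩ := (memX _ _).1 ha
    exact h2 b
  have hB : ∀ i j, B i j = #{l | (i, j) ∈ X l} := fun i j => by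
    have : ({l | (i, j) ∈ X l} : Finset (Fin m)) =
        (univ : Finset (Fin (B i j))).image fun x => ℓ ⟨(i, j), x⟩ := by
      ext l
      simp only [mem_filter, memX, mem_image, mem_univ, true_and]
      constructor
      · rintro ⟨⟨a, x⟩, hb, rfl⟩
        exact ⟨x, hb⟩
      · rintro ⟨x, rfl⟩
        exact ⟨_, rfl, rfl⟩
    rw [this, card_image_of_injective, card_univ, Fintype.card_fin]
    intro x y hxy
    simpa using heq _ _ hxy le_rfl
  let T : Fin m → Finset (Fin k × Fin p) := fun l => uncorner (X l) (r l) (c l)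
  have hT : ∀ l, IsAntichain (· ≤ ·) (T l : Set (Fin k × Fin p)) := fun l =>
    isAntichain_uncorner (hrX l) (hcX l)
  have hcorners : ∀ l, corners (T l) = X l := fun l => corners_uncorner (hX l) (hrX l) (hcX l)
  have hnest : ∀ l l' : Fin m, (l : ℕ) + 1 = l' → ∀ a ∈ T l', ∃ a' ∈ T l, a' ≤ a := by
    intro l l' hl a ha
    obtain ⟨ha1, ha2, ha3⟩ := (exists_mem_uncorner_le_iff (hrX l') (hcX l')).1 ⟨a, ha, le_rfl⟩
    have hle : l ≤ l' := Fin.le_def.2 (by omega)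
    refine (exists_mem_uncorner_le_iff (hrX l) (hcX l)).2
      ⟨(hr hle).trans ha1, (hc hle).trans ha2, fun x hx hax => ?_⟩
    obtain ⟨b, rfl, rfl⟩ := (memX _ _).1 hx
    obtain ⟨b', hb', rfl⟩ := h4 b l' hl (ha1.trans_lt hax.1) (ha2.trans_lt hax.2)
    exact ha3 b'.1 ((memX _ _).2 ⟨b', rfl, rfl⟩)
      ⟨hax.1.trans_le hb'.1, hax.2.trans_le hb'.2.1⟩
  have hBT : ∀ i j, B i j = #{l | (i, j) ∈ corners (T l)} := fun i j => by
    simp only [hcorners]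
    exact hB i j
  refine ⟨fun i j => #{l | (i, j) ∈ T l}, ?_, ?_, ?_⟩
  · ext i j
    rw [hBT]
    exact nextMatrix_of_nested (fun _ _ => rfl) hT hnest i j
  · exact rowVec_eq_add_card (fun l _ => hT l) (fun _ _ => rfl) hBT
      (fun l _ _ => le_fst_of_mem_uncorner (hrX l))
      (fun l _ => exists_mem_uncorner_fst_eq (hrX l))
  · exact colVec_eq_add_card (fun l _ => hT l) (fun _ _ => rfl) hBT
      (fun l _ _ => le_snd_of_mem_uncorner (hcX l))
      (fun l _ => exists_mem_uncorner_snd_eq (hcX l))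

theorem xPow_injective (F : Type*) [Field F] :
    Function.Injective (xPow F : Matrix (Fin k) (Fin p) ℕ → MvPolynomial (Fin k × Fin p) F) := by
  have h : ∀ A : Matrix (Fin k) (Fin p) ℕ, xPow F A = MvPolynomial.monomial
      (Finsupp.equivFunOnFinite.symm fun c : Fin k × Fin p => A c.1 c.2) 1 := fun A => by
    rw [MvPolynomial.monomial_eq, map_one, one_mul, Finsupp.prod_fintype _ _ (by simp), xPow,
      Fintype.prod_prod_type]
    rfl
  intro A B hAB
  rw [h, h] at hAB
  have := Finsupp.equivFunOnFinite.symm.injective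
    (MvPolynomial.monomial_left_injective (one_ne_zero (α := F)) hAB)
  ext i j
  exact congrFun this (i, j)

end MatrixBall

theorem mainTheorem7 (F : Type*) [Field F] (n k p : ℕ) (α : Fin k → ℕ) (β : Fin p → ℕ)
    (hα : MatrixBall.IsWeakComposition n α) (hβ : MatrixBall.IsWeakComposition n β)
    (B : Matrix (Fin k) (Fin p) ℕ) (hB : B ∈ MatrixBall.subtingencyTables α β) :
    (∃ A ∈ MatrixBall.contingencyTables α β, MatrixBall.xPow F B = MatrixBall.mb F A) ↔
      (∀ i : Fin k,
        ∑ q ∈ Finset.Iic i, (MatrixBall.northernCount B q : ℤ) ≤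
          ∑ q ∈ Finset.Iio i, ((α q : ℤ) - (MatrixBall.rowVec B q : ℤ))) ∧
      (∀ j : Fin p,
        ∑ q ∈ Finset.Iic j, (MatrixBall.westernCount B q : ℤ) ≤
          ∑ q ∈ Finset.Iio j, ((β q : ℤ) - (MatrixBall.colVec B q : ℤ))) := by
  constructor
  · rintro ⟨A, ⟨hrow, hcol⟩, hAB⟩
    obtain rfl := MatrixBall.xPow_injective F hAB
    refine ⟨fun i => ?_, fun j => ?_⟩
    · simp only [← hrow]
      exact MatrixBall.sum_northernCount_nextMatrix_le i
    · simp only [← hcol, MatrixBall.westernCount_eq, ← MatrixBall.nextMatrix_transpose]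
      refine (MatrixBall.sum_northernCount_nextMatrix_le (A := A.transpose) j).trans_eq ?_
      rw [MatrixBall.nextMatrix_transpose]
      rfl
  · rintro ⟨hnorth, hwest⟩
    have hsum : ∑ i, MatrixBall.rowVec B i = ∑ j, MatrixBall.colVec B j := Finset.sum_comm
    have hα' : ∑ i, (α i - MatrixBall.rowVec B i) = n - ∑ i, MatrixBall.rowVec B i := by
      rw [Finset.sum_tsub_distrib _ fun i _ => hB.1 i, hα]
    have hβ' : ∑ j, (β j - MatrixBall.colVec B j) = n - ∑ i, MatrixBall.rowVec B i := by
      rw [Finset.sum_tsub_distrib _ fun j _ => hB.2 j, hβ, hsum]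
    obtain ⟨r, hr, hr'⟩ := MatrixBall.exists_monotone_card_fiber _ hα'
    obtain ⟨c, hc, hc'⟩ := MatrixBall.exists_monotone_card_fiber _ hβ'
    obtain ⟨A, rfl, hrow, hcol⟩ := MatrixBall.exists_nextMatrix_eq (B := B) hr hc
      (fun i => by
        simp only [hr']
        zify [hB.1]
        exact hnorth i)
      (fun j => by
        simp only [hc']
        zify [hB.2]
        exact hwest j)
    refine ⟨A, ⟨fun i => ?_, fun j => ?_⟩, rfl⟩
    · rw [hrow, hr', Nat.add_sub_cancel' (hB.1 i)]
    · rw [hcol, hc', Nat.add_sub_cancel' (hB.2 j)]
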